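/- Let $\mathcal{V}$ be a locally presentable braided monoidal closed category (that is, a braided monoidal category, with braiding $c$, whose underlying category is locally presentable and in which every functor $-\otimes X$ has a right adjoint $[X,-]$, with evaluation $\mathrm{ev}\colon [X,Y]\otimes X\to Y$). Write $\mathbf{Mon}(\mathcal{V})$ and $\mathbf{Comon}(\mathcal{V})$ for the categories of monoids and of comonoids in $\mathcal{V}$. For a comonoid $(C,\Delta,\varepsilon)$ and a monoid $(B,\mu,\iota)$, the internal hom $[C,B]$ is a monoid (the convolution monoid): its multiplication is the transpose of $$[C,B]\otimes[C,B]\otimes C\xrightarrow{1\otimes 1\otimes\Delta}[C,B]\otimes[C,B]\otimes C\otimes C\xrightarrow{1\otimes c\otimes 1}[C,B]\otimes C\otimes[C,B]\otimes C\xrightarrow{\mathrm{ev}\otimes\mathrm{ev}}B\otimes B\xrightarrow{\mu}B,$$ and its unit is the transpose of $I\otimes C\cong C\xrightarrow{\varepsilon}I\xrightarrow{\iota}B$. This defines a functor $[-,-]\colon\mathbf{Comon}(\mathcal{V})^{\mathrm{op}}\times\mathbf{Mon}(\mathcal{V})\to\mathbf{Mon}(\mathcal{V})$. Then, for every monoid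 $B$ in $\mathcal{V}$, the functor $[-,B]^{\mathrm{op}}\colon\mathbf{Comon}(\mathcal{V})\to\mathbf{Mon}(\mathcal{V})^{\mathrm{op}}$ has a right adjoint $P(-,B)\colon\mathbf{Mon}(\mathcal{V})^{\mathrm{op}}\to\mathbf{Comon}(\mathcal{V})$; that is, there are bijections $$\mathbf{Mon}(\mathcal{V})(A,[C,B])\;\cong\;\mathbf{Comon}(\mathcal{V})(C,P(A,B)),$$ natural in the monoid $A$ and in the comonoid $C$. (The object $P(A,B)$ is called the universal measuring comonoid of $A$ and $B$.) -/

import Mathlib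

open CategoryTheory MonoidalCategory Opposite
open scoped MonObj ComonObj

universe v u

set_option linter.unusedSectionVars false

namespace InternalHomMon

variable {V : Type u} [Category.{v} V] [MonoidalCategory V] [BraidedCategory V]
  [MonoidalClosed V]

/-- The evaluation `[X, Y] ⊗ X ⟶ Y` exhibiting the internal hom `[X, -]` as a right adjoint of
`- ⊗ X`, obtained from that of `X ⊗ -` along the braiding `c : [X, Y] ⊗ X ≅ X ⊗ [X, Y]`. -/
def ev (X Y : V) : (ihom X).obj Y ⊗ X ⟶ Y :=
  (β_ ((ihom X).obj Y) X).hom ≫ (ihom.ev X).app Y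

/-- Transposition along the adjunction between `- ⊗ X` and `[X, -]`. -/
def transpose {X Y Z : V} (f : Z ⊗ X ⟶ Y) : Z ⟶ (ihom X).obj Y :=
  MonoidalClosed.curry ((β_ Z X).inv ≫ f)

lemma whiskerRight_ev {X Y Z : V} (g : Z ⟶ (ihom X).obj Y) :
    g ▷ X ≫ ev X Y = (β_ Z X).hom ≫ MonoidalClosed.uncurry g := by
  simp [ev, MonoidalClosed.uncurry_eq]

@[simp]
lemma transpose_ev {X Y Z : V} (f : Z ⊗ X ⟶ Y) : transpose f ▷ X ≫ ev X Y = f := by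
  simp [whiskerRight_ev, transpose]

lemma ext_ev {X Y Z : V} {g h : Z ⟶ (ihom X).obj Y} (w : g ▷ X ≫ ev X Y = h ▷ X ≫ ev X Y) :
    g = h := by
  rw [whiskerRight_ev, whiskerRight_ev, cancel_epi] at w
  exact MonoidalClosed.uncurry_injective w

/-- `transpose` is the bijection of hom-sets of an adjunction between `- ⊗ X` and `[X, -]`. -/
def transposeEquiv (X Y Z : V) : (Z ⊗ X ⟶ Y) ≃ (Z ⟶ (ihom X).obj Y) where
  toFun := transpose
  invFun g := g ▷ X ≫ ev X Y
  left_inv := transpose_ev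
  right_inv _ := ext_ev (transpose_ev _)

lemma map_ev (X : V) {Y Y' : V} (g : Y ⟶ Y') : (ihom X).map g ▷ X ≫ ev X Y' = ev X Y ≫ g := by
  simp [ev]

lemma pre_ev {X X' : V} (f : X' ⟶ X) (Y : V) :
    (MonoidalClosed.pre f).app Y ▷ X' ≫ ev X' Y = (ihom X).obj Y ◁ f ≫ ev X Y := by
  simp [ev]

section Convolution

variable (C B : V) [ComonObj C] [MonObj B]

/-- The unit of `[C, B]`, the transpose of `I ⊗ C ≅ C ⟶ I ⟶ B`. -/
def convOne : 𝟙_ V ⟶ (ihom C).obj B :=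
  transpose ((λ_ C).hom ≫ ε[C] ≫ η[B])

/-- The multiplication of `[C, B]`, the transpose of
`[C, B] ⊗ [C, B] ⊗ C ⟶ [C, B] ⊗ [C, B] ⊗ C ⊗ C ≅ [C, B] ⊗ C ⊗ [C, B] ⊗ C ⟶ B ⊗ B ⟶ B`,
where the middle isomorphism is `1 ⊗ c ⊗ 1` for the braiding `c : [C, B] ⊗ C ≅ C ⊗ [C, B]`. -/
def convMul : (ihom C).obj B ⊗ (ihom C).obj B ⟶ (ihom C).obj B :=
  transpose (((ihom C).obj B ⊗ (ihom C).obj B) ◁ Δ[C] ≫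
    tensorμ ((ihom C).obj B) ((ihom C).obj B) C C ≫ (ev C B ⊗ₘ ev C B) ≫ μ[B])

lemma convOne_ev : convOne C B ▷ C ≫ ev C B = (λ_ C).hom ≫ ε[C] ≫ η[B] := transpose_ev _

lemma convMul_ev : convMul C B ▷ C ≫ ev C B =
    ((ihom C).obj B ⊗ (ihom C).obj B) ◁ Δ[C] ≫
      tensorμ ((ihom C).obj B) ((ihom C).obj B) C C ≫ (ev C B ⊗ₘ ev C B) ≫ μ[B] :=
  transpose_ev _

variable {C B}

/-- The convolution product of two morphisms `Z ⊗ C ⟶ B` and `W ⊗ C ⟶ B`. -/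
def convProd {Z W : V} (f : Z ⊗ C ⟶ B) (g : W ⊗ C ⟶ B) : (Z ⊗ W) ⊗ C ⟶ B :=
  (Z ⊗ W) ◁ Δ[C] ≫ tensorμ Z W C C ≫ (f ⊗ₘ g) ≫ μ[B]

lemma convMul_ev' : convMul C B ▷ C ≫ ev C B = convProd (ev C B) (ev C B) := transpose_ev _

lemma tensorHom_convProd {Z Z' W W' : V} (a : Z' ⟶ Z) (b : W' ⟶ W) (f : Z ⊗ C ⟶ B)
    (g : W ⊗ C ⟶ B) :
    (a ⊗ₘ b) ▷ C ≫ convProd f g = convProd (a ▷ C ≫ f) (b ▷ C ≫ g) := by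
  simp only [convProd]
  rw [← whisker_exchange_assoc, tensorμ_natural_left_assoc]
  simp

lemma tensorHom_convMul_ev {Z W : V} (f : Z ⟶ (ihom C).obj B) (g : W ⟶ (ihom C).obj B) :
    ((f ⊗ₘ g) ≫ convMul C B) ▷ C ≫ ev C B = convProd (f ▷ C ≫ ev C B) (g ▷ C ≫ ev C B) := by
  rw [comp_whiskerRight, Category.assoc, convMul_ev', tensorHom_convProd]

lemma one_convProd {W : V} (g : W ⊗ C ⟶ B) :
    convProd ((λ_ C).hom ≫ ε[C] ≫ η[B]) g = (λ_ W).hom ▷ C ≫ g := by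
  have h1 : ((λ_ C).hom ≫ ε[C] ≫ η[B]) ⊗ₘ g =
      (𝟙_ V ◁ ε[C] ⊗ₘ W ◁ 𝟙 C) ≫ (λ_ (𝟙_ V)).hom ▷ (W ⊗ C) ≫ 𝟙_ V ◁ g ≫ η[B] ▷ B := by
    rw [whisker_exchange, MonoidalCategory.whiskerLeft_id, tensorHom_id,
      ← comp_whiskerRight_assoc, ← comp_whiskerRight_assoc, leftUnitor_naturality,
      ← MonoidalCategory.tensorHom_def]
    simp
  rw [convProd, h1]
  simp only [Category.assoc, MonObj.one_mul, leftUnitor_naturality]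
  rw [← tensorμ_natural_right_assoc, tensorHom_id, ← MonoidalCategory.whiskerLeft_comp_assoc,
    ComonObj.counit_comul, ← leftUnitor_monoidal_assoc, MonoidalCategory.tensorHom_def']
  simp

lemma convProd_one {Z : V} (f : Z ⊗ C ⟶ B) :
    convProd f ((λ_ C).hom ≫ ε[C] ≫ η[B]) = (ρ_ Z).hom ▷ C ≫ f := by
  have h1 : f ⊗ₘ ((λ_ C).hom ≫ ε[C] ≫ η[B]) =
      (Z ◁ 𝟙 C ⊗ₘ 𝟙_ V ◁ ε[C]) ≫ (Z ⊗ C) ◁ (λ_ (𝟙_ V)).hom ≫ f ▷ 𝟙_ V ≫ B ◁ η[B] := by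
    rw [← whisker_exchange, MonoidalCategory.whiskerLeft_id, id_tensorHom,
      ← MonoidalCategory.whiskerLeft_comp_assoc, ← MonoidalCategory.whiskerLeft_comp_assoc,
      leftUnitor_naturality, ← MonoidalCategory.tensorHom_def']
    simp
  rw [convProd, h1]
  simp only [Category.assoc, MonObj.mul_one, rightUnitor_naturality]
  rw [← tensorμ_natural_right_assoc, id_tensorHom, ← MonoidalCategory.whiskerLeft_comp_assoc,
    ComonObj.comul_counit, ← rightUnitor_monoidal_assoc, MonoidalCategory.tensorHom_def']
  simp

lemma convProd_assoc {X Y Z : V} (f : X ⊗ C ⟶ B) (g : Y ⊗ C ⟶ B) (h : Z ⊗ C ⟶ B) :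
    convProd (convProd f g) h = (α_ X Y Z).hom ▷ C ≫ convProd f (convProd g h) := by
  have hl : convProd f g ⊗ₘ h = ((X ⊗ Y) ◁ Δ[C] ⊗ₘ Z ◁ 𝟙 C) ≫
      tensorμ X Y C C ▷ (Z ⊗ C) ≫ ((f ⊗ₘ g) ⊗ₘ h) ≫ μ[B] ▷ B := by
    simp only [convProd, ← tensorHom_id, tensorHom_comp_tensorHom, Category.id_comp,
      Category.comp_id, MonoidalCategory.whiskerLeft_id]
  have hr : f ⊗ₘ convProd g h = (X ◁ 𝟙 C ⊗ₘ (Y ⊗ Z) ◁ Δ[C]) ≫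
      (X ⊗ C) ◁ tensorμ Y Z C C ≫ (f ⊗ₘ (g ⊗ₘ h)) ≫ B ◁ μ[B] := by
    rw [MonoidalCategory.whiskerLeft_id]
    simp only [convProd, ← id_tensorHom, tensorHom_comp_tensorHom, Category.id_comp,
      Category.comp_id]
  rw [convProd, hl, convProd, hr]
  simp only [Category.assoc]
  rw [← tensorμ_natural_right_assoc, ← tensorμ_natural_right_assoc, MonObj.mul_assoc,
    associator_naturality_assoc, associator_monoidal_assoc, tensorHom_id, id_tensorHom,
    ← MonoidalCategory.whiskerLeft_comp_assoc, ← MonoidalCategory.whiskerLeft_comp_assoc,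
    MonoidalCategory.tensorHom_def', ComonObj.comul_assoc]
  simp only [← whisker_exchange_assoc, ← MonoidalCategory.whiskerLeft_comp_assoc, Category.assoc]

variable (C B)

/-- The convolution monoid `[C, B]` of a comonoid `C` and a monoid `B`. -/
@[reducible]
def convMonObj : MonObj ((ihom C).obj B) where
  one := convOne C B
  mul := convMul C B
  one_mul := by
    apply ext_ev
    rw [← tensorHom_id _ ((ihom C).obj B), tensorHom_convMul_ev, convOne_ev, one_convProd]
    simp
  mul_one := by
    apply ext_ev
    rw [← id_tensorHom ((ihom C).obj B), tensorHom_convMul_ev, convOne_ev, convProd_one]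
    simp
  mul_assoc := by
    apply ext_ev
    rw [← tensorHom_id _ ((ihom C).obj B), ← id_tensorHom ((ihom C).obj B),
      comp_whiskerRight (α_ _ _ _).hom, Category.assoc, tensorHom_convMul_ev,
      tensorHom_convMul_ev, convMul_ev']
    simp [convProd_assoc]

end Convolution

section Functoriality

attribute [local instance] convMonObj

variable {C C' C'' B B' B'' : V}

/-- The morphism `[f, g] : [C, B] ⟶ [C', B']` for `f : C' ⟶ C` and `g : B ⟶ B'`. -/
def homMap (f : C' ⟶ C) (g : B ⟶ B') : (ihom C).obj B ⟶ (ihom C').obj B' :=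
  (MonoidalClosed.pre f).app B ≫ (ihom C').map g

lemma homMap_ev (f : C' ⟶ C) (g : B ⟶ B') :
    homMap f g ▷ C' ≫ ev C' B' = (ihom C).obj B ◁ f ≫ ev C B ≫ g := by
  rw [homMap, comp_whiskerRight, Category.assoc, map_ev, reassoc_of% pre_ev]

lemma homMap_id (C B : V) : homMap (𝟙 C) (𝟙 B) = 𝟙 ((ihom C).obj B) := by
  simp [homMap]

lemma homMap_comp (f : C' ⟶ C) (f' : C'' ⟶ C') (g : B ⟶ B') (g' : B' ⟶ B'') :
    homMap (f' ≫ f) (g ≫ g') = homMap f g ≫ homMap f' g' := by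
  simp [homMap]

instance homMap_isMonHom [ComonObj C] [ComonObj C'] [MonObj B] [MonObj B'] (f : C' ⟶ C)
    (g : B ⟶ B') [IsComonHom f] [IsMonHom g] : IsMonHom (homMap f g) where
  one_hom := by
    change convOne C B ≫ _ = convOne C' B'
    apply ext_ev
    rw [comp_whiskerRight, Category.assoc, homMap_ev, convOne_ev, ← whisker_exchange_assoc,
      reassoc_of% convOne_ev]
    simp
  mul_hom := by
    change convMul C B ≫ _ = (_ ⊗ₘ _) ≫ convMul C' B'
    apply ext_ev
    rw [tensorHom_convMul_ev, homMap_ev, comp_whiskerRight, Category.assoc, homMap_ev,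
      ← whisker_exchange_assoc, reassoc_of% convMul_ev, convProd, ← tensorHom_comp_tensorHom_assoc,
      ← tensorμ_natural_right_assoc, ← MonoidalCategory.whiskerLeft_comp_assoc,
      ← MonoidalCategory.whiskerLeft_comp_assoc, IsComonHom.hom_comul,
      ← tensorHom_comp_tensorHom_assoc, IsMonHom.mul_hom]

end Functoriality

/-- The convolution monoid `[C, B]` as an object of the category of monoids. -/
def convMon (C : Comon V) (B : Mon V) : Mon V where
  X := (ihom C.X).obj B.X
  mon := convMonObj C.X B.X

/-- The morphism of monoids `[f, g] : [C, B] ⟶ [C', B']` for a morphism of comonoids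
`f : C' ⟶ C` and a morphism of monoids `g : B ⟶ B'`. -/
def convMonMap {C C' : Comon V} (f : C' ⟶ C) {B B' : Mon V} (g : B ⟶ B') :
    convMon C B ⟶ convMon C' B' where
  hom := homMap f.hom g.hom
  isMonHom_hom := homMap_isMonHom f.hom g.hom

lemma convMonMap_id (C : Comon V) (B : Mon V) :
    convMonMap (𝟙 C) (𝟙 B) = 𝟙 (convMon C B) :=
  Mon.Hom.ext (homMap_id C.X B.X)

lemma convMonMap_comp {C C' C'' : Comon V} (f : C' ⟶ C) (f' : C'' ⟶ C') {B B' B'' : Mon V}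
    (g : B ⟶ B') (g' : B' ⟶ B'') :
    convMonMap (f' ≫ f) (g ≫ g') = convMonMap f g ≫ convMonMap f' g' :=
  Mon.Hom.ext (homMap_comp f.hom f'.hom g.hom g'.hom)

/-- The functor `[-, -] : Comon(V)ᵒᵖ × Mon(V) ⥤ Mon(V)` given by convolution monoids. -/
@[simps]
def convMonFunctor : (Comon V)ᵒᵖ × Mon V ⥤ Mon V where
  obj p := convMon p.1.unop p.2
  map f := convMonMap f.1.unop f.2
  map_id p := convMonMap_id p.1.unop p.2
  map_comp f g := convMonMap_comp f.1.unop g.1.unop f.2 g.2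

/-- The functor `[-, B]ᵒᵖ : Comon(V) ⥤ Mon(V)ᵒᵖ`. -/
@[simps]
def convMonOp (B : Mon V) : Comon V ⥤ (Mon V)ᵒᵖ where
  obj C := op (convMon C B)
  map f := (convMonMap f (𝟙 B)).op
  map_id C := by rw [convMonMap_id, op_id]
  map_comp f f' := by
    rw [← op_comp, ← convMonMap_comp, Category.comp_id]

/-- `[-, B]ᵒᵖ` is the opposite of the functor `[-, B]` obtained from the functor `[-, -]` of two
variables by fixing the second one. -/
lemma convMonOp_eq (B : Mon V) :
    convMonOp B = (Prod.sectL (Comon V)ᵒᵖ B ⋙ convMonFunctor).rightOp := rfl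

end InternalHomMon

/-! The functor `[-, B]ᵒᵖ` is cocontinuous: colimits of comonoids are computed in `V`, the internal
hom turns them into limits, and limits of monoids are detected in `V`. By the adjoint functor
theorem it remains to find an essentially small class of comonoids of which every comonoid is a
small colimit.

For an uncountable regular `κ` with `V` locally `κ`-presentable, the comonoids with `κ`-presentable
underlying object are such a class (`Comon.exists_colimitsOfShape_isPresentable`). The core is
`ComulLift.exists_comonObj`. Write the underlying object of `C` as a `κ`-filtered colimit of
`κ`-presentable objects `X j`. Filtered colimits commute with tensor powers, so the comultiplication
restricted to `X j` lifts to `X j ⟶ X k ⊗ X k`, and each comonoid axiom, valid in the colimit,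
already holds at a later stage. Iterating gives a countable chain whose colimit is a comonoid over
`C`; it is still `κ`-presentable because `κ` is uncountable. Presentable comonoids over `C`
therefore contain and identify enough elements for their canonical colimit to be `C`. -/

section

open Limits

/-! ### An adjoint functor theorem -/

namespace CategoryTheory

universe u'

/-- A cocontinuous functor out of a cocomplete category is a left adjoint as soon as every object
of the source is a small colimit of objects satisfying an essentially small property. -/
theorem Functor.isLeftAdjoint_of_exists_colimitsOfShape {C : Type u} [Category.{v} C]
    [HasColimits C] {D : Type u'} [Category.{v} D] (P : ObjectProperty C)
    [ObjectProperty.EssentiallySmall.{v} P]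
    (hP : ∀ X : C, ∃ (J : Type v) (_ : SmallCategory J), P.colimitsOfShape J X)
    (F : C ⥤ D) [PreservesColimits F] : F.IsLeftAdjoint := by
  have : F.op.IsRightAdjoint := by
    have := preservesLimits_op F
    apply isRightAdjoint_of_preservesLimits_of_solutionSetCondition
    intro A
    -- The colimit of this essentially small comma category carries a map `t` through which every `F
    -- X ⟶ A` factors, since `X` is a colimit of objects of `P`. One object thus forms a solution
    -- set.
    let K := CostructuredArrow (P.ι ⋙ F) A.unop
    have : HasColimitsOfShape K C :=
      hasColimitsOfShape_of_equivalence (equivSmallModel.{v} K).symm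
    have : PreservesColimitsOfShape K F :=
      preservesColimitsOfShape_of_equiv (equivSmallModel.{v} K).symm F
    let Φ : K ⥤ C := CostructuredArrow.proj (P.ι ⋙ F) A.unop ⋙ P.ι
    let s : Cocone (Φ ⋙ F) := ⟨A.unop, ⟨fun k ↦ k.hom,
      fun _ _ f ↦ (CostructuredArrow.w f).trans (Category.comp_id _).symm⟩⟩
    let t : F.obj (colimit Φ) ⟶ A.unop :=
      (isColimitOfPreserves F (colimit.isColimit Φ)).desc s
    have ht (k : K) : F.map (colimit.ι Φ k) ≫ t = k.hom :=
      (isColimitOfPreserves F (colimit.isColimit Φ)).fac s k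
    refine ⟨PUnit, fun _ ↦ op (colimit Φ), fun _ ↦ t.op, fun X h ↦ ⟨⟨⟩, ?_⟩⟩
    obtain ⟨J, _, ⟨p⟩⟩ := hP X.unop
    let κ (j : J) : K :=
      CostructuredArrow.mk (Y := ⟨p.diag.obj j, p.prop_diag_obj j⟩)
        (show (P.ι ⋙ F).obj _ ⟶ A.unop from F.map (p.ι.app j) ≫ h.unop)
    let c : Cocone p.diag :=
      ⟨colimit Φ,
        { app := fun j ↦ colimit.ι Φ (κ j)
          naturality := fun j j' f ↦ by
            have hf := p.ι.naturality f
            dsimp at hf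
            let m : κ j ⟶ κ j' := CostructuredArrow.homMk (ObjectProperty.homMk (p.diag.map f))
              (by simp [κ, ← F.map_comp_assoc, hf])
            exact (colimit.w Φ m).trans (Category.comp_id _).symm }⟩
    refine ⟨(p.isColimit.desc c).op, Quiver.Hom.unop_inj ?_⟩
    refine (isColimitOfPreserves F p.isColimit).hom_ext fun j ↦ ?_
    have : F.map (p.ι.app j) ≫ F.map (p.isColimit.desc c) = F.map (colimit.ι Φ (κ j)) := by
      rw [← F.map_comp]
      congr 1
      exact p.isColimit.fac c j
    exact (Category.assoc _ _ _).symm.trans ((congrArg (· ≫ t) this).trans (ht (κ j)))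
  exact ⟨_, ⟨(Adjunction.ofIsRightAdjoint F.op).unop⟩⟩

/-! ### Colimits of comonoids and sifted colimits of tensor products -/

section

variable {C : Type u} [Category.{v} C] [MonoidalCategory C]

/-- Comonoids in `C` are the opposite of monoids in `Cᵒᵖ`, so colimits of comonoids come from limits
of monoids. -/
instance Comon.hasColimitsOfShape (J : Type*) [Category* J] [HasColimitsOfShape J C] :
    HasColimitsOfShape J (Comon C) := by
  have : HasColimitsOfShape Jᵒᵖᵒᵖ C := hasColimitsOfShape_of_equivalence (opOpEquivalence J).symm
  have := hasLimitsOfShape_op_of_hasColimitsOfShape (J := Jᵒᵖ) (C := C)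
  exact Adjunction.hasColimitsOfShape_of_equivalence (Comon.Comon_EquivMon_OpOp C).functor

instance Comon.hasColimits [HasColimits C] : HasColimits (Comon C) := ⟨fun _ _ ↦ inferInstance⟩

instance Comon.preservesColimitsOfShape_forget (J : Type*) [Category* J] [HasColimitsOfShape J C] :
    PreservesColimitsOfShape J (Comon.forget C) := by
  have : HasColimitsOfShape Jᵒᵖᵒᵖ C := hasColimitsOfShape_of_equivalence (opOpEquivalence J).symm
  have := hasLimitsOfShape_op_of_hasColimitsOfShape (J := Jᵒᵖ) (C := C)
  have : PreservesColimitsOfShape J (Mon.forget Cᵒᵖ).leftOp :=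
    preservesColimitsOfShape_leftOp _ _
  exact preservesColimitsOfShape_of_natIso
    (show (Comon.Comon_EquivMon_OpOp C).functor ⋙ (Mon.forget Cᵒᵖ).leftOp ≅ Comon.forget C from
      Iso.refl _)

end

/-- The tensor product of two functors preserving sifted colimits preserves sifted colimits. -/
lemma preservesColimitsOfShape_prod'_tensor {V : Type u} [Category.{v} V] [MonoidalCategory V]
    {D : Type*} [Category* D] {J : Type*} [Category* J] [IsSifted J]
    [∀ X : V, PreservesColimitsOfShape J (tensorLeft X)]
    [∀ X : V, PreservesColimitsOfShape J (tensorRight X)] (F G : D ⥤ V)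
    [PreservesColimitsOfShape J F] [PreservesColimitsOfShape J G] :
    PreservesColimitsOfShape J (F.prod' G ⋙ tensor V) where
  preservesColimit {K} := ⟨fun {c} hc ↦ ⟨by
    have (X : V) : PreservesColimit (K ⋙ F) ((curriedTensor V).flip.obj X) :=
      inferInstanceAs (PreservesColimit _ (tensorRight X))
    have (X : V) : PreservesColimit (K ⋙ G) ((curriedTensor V).obj X) :=
      inferInstanceAs (PreservesColimit _ (tensorLeft X))
    have h := isColimitOfPreserves₂ (curriedTensor V) (isColimitOfPreserves F hc)
      (isColimitOfPreserves G hc)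
    -- Siftedness is used here: the diagonal of `J` is final, so the colimit over `J × J` can be
    -- computed on the diagonal.
    have h' := (Functor.Final.isColimitWhiskerEquiv (Functor.diag J) _).symm h
    let e : Functor.diag J ⋙ Functor.uncurry.obj
        (((Functor.whiskeringLeft₂ V).obj (K ⋙ F)).obj (K ⋙ G) |>.obj (curriedTensor V)) ≅
        K ⋙ F.prod' G ⋙ tensor V :=
      NatIso.ofComponents (fun _ ↦ Iso.refl _)
        (fun f ↦ by simp [MonoidalCategory.tensorHom_def])
    exact IsColimit.ofIsoColimit ((IsColimit.precomposeInvEquiv e _).symm h')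
      (Cocone.ext (Iso.refl _) (fun j ↦ by
        simp only [Functor.mapCocone_ι_app, Functor.comp_map, Functor.prod'_map, tensor_map,
          MonoidalCategory.tensorHom_def]
        exact (Category.comp_id _).trans (Category.id_comp _)))⟩⟩

end CategoryTheory

/-! ### Cocontinuity of the convolution functor -/

namespace InternalHomMon

variable {V : Type u} [Category.{v} V] [MonoidalCategory V] [BraidedCategory V]
  [MonoidalClosed V]

/-- After forgetting to `V` this is the contravariant internal hom into `B`, which turns colimits
into limits; the forgetful functor from monoids reflects those limits. -/
instance convMonOp_preservesColimits [HasColimits V] (B : Mon V) :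
    PreservesColimits (convMonOp B) where
  preservesColimitsOfShape {J} _ := by
    have := hasLimitsOfShape_op_of_hasColimitsOfShape (J := J) (C := Comon V)
    have : PreservesLimitsOfShape Jᵒᵖ (Comon.forget V).op := preservesLimitsOfShape_op _ _
    let e : (convMonOp B).leftOp ⋙ Mon.forget V ≅
        (Comon.forget V).op ⋙ MonoidalClosed.internalHom.flip.obj B.X :=
      NatIso.ofComponents (fun _ ↦ Iso.refl _) (fun f ↦ by
        simp only [Functor.comp_map, Functor.leftOp_map, convMonOp_map]
        refine (Category.comp_id _).trans (Eq.trans ?_ (Category.id_comp _).symm)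
        exact (congrArg (_ ≫ ·) ((ihom _).map_id _)).trans (Category.comp_id _))
    have : PreservesLimitsOfShape Jᵒᵖ ((convMonOp B).leftOp ⋙ Mon.forget V) :=
      preservesLimitsOfShape_of_natIso e.symm
    have : PreservesLimitsOfShape Jᵒᵖ (convMonOp B).leftOp :=
      preservesLimitsOfShape_of_reflects_of_preserves _ (Mon.forget V)
    exact preservesColimitsOfShape_of_leftOp _ _

end InternalHomMon

/-! ### Comonoids as colimits of chains -/

namespace CategoryTheory

/-- A sequence of objects over a comonoid `C` with maps `X n ⟶ X (n + 1) ⊗ X (n + 1)` lifting the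
comultiplication of `C` and satisfying the axioms of a comonoid up to the transition maps. -/
structure ComonChain {V : Type u} [Category.{v} V] [MonoidalCategory V] (C : V) [ComonObj C] where
  /-- the objects of the sequence -/
  X : ℕ → V
  /-- the transition maps -/
  f (n : ℕ) : X n ⟶ X (n + 1)
  /-- the partial comultiplications -/
  d (n : ℕ) : X n ⟶ X (n + 1) ⊗ X (n + 1)
  /-- the structure maps to the comonoid -/
  p (n : ℕ) : X n ⟶ C
  f_p (n : ℕ) : f n ≫ p (n + 1) = p n
  d_p (n : ℕ) : d n ≫ (p (n + 1) ⊗ₘ p (n + 1)) = p n ≫ Δ[C]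
  d_counit_left (n : ℕ) : d n ≫ (p (n + 1) ≫ ε[C]) ▷ X (n + 1) = f n ≫ (λ_ _).inv
  d_counit_right (n : ℕ) : d n ≫ X (n + 1) ◁ (p (n + 1) ≫ ε[C]) = f n ≫ (ρ_ _).inv
  f_d (n : ℕ) : f n ≫ d (n + 1) = d n ≫ (f (n + 1) ⊗ₘ f (n + 1))
  d_assoc (n : ℕ) : d n ≫ (d (n + 1) ⊗ₘ f (n + 1)) ≫ (α_ _ _ _).hom =
    d n ≫ (f (n + 1) ⊗ₘ d (n + 1))

namespace ComonChain

variable {V : Type u} [Category.{v} V] [MonoidalCategory V] {C : V} [ComonObj C]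
  (s : ComonChain C) [HasColimitsOfShape ℕ V]

/-- The colimit of the sequence. -/
noncomputable def pt : V := colimit (Functor.ofSequence s.f)

/-- The maps to the colimit. -/
noncomputable def inj (n : ℕ) : s.X n ⟶ s.pt := colimit.ι (Functor.ofSequence s.f) n

@[simp]
lemma f_inj (n : ℕ) : s.f n ≫ s.inj (n + 1) = s.inj n := by
  have := colimit.w (Functor.ofSequence s.f) (homOfLE (Nat.le_add_right n 1))
  rwa [Functor.ofSequence_map_homOfLE_succ] at this

lemma exists_desc {Y : V} (g : ∀ n, s.X n ⟶ Y) (hg : ∀ n, s.f n ≫ g (n + 1) = g n) :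
    ∃ h : s.pt ⟶ Y, ∀ n, s.inj n ≫ h = g n :=
  ⟨colimit.desc (Functor.ofSequence s.f) ⟨Y, NatTrans.ofSequence g (fun n ↦ by
    rw [Functor.ofSequence_map_homOfLE_succ]
    exact (hg n).trans (Category.comp_id _).symm)⟩,
    fun n ↦ colimit.ι_desc _ _⟩

/-- Descent of a compatible family of maps to the colimit. -/
noncomputable def desc {Y : V} (g : ∀ n, s.X n ⟶ Y) (hg : ∀ n, s.f n ≫ g (n + 1) = g n) :
    s.pt ⟶ Y :=
  (s.exists_desc g hg).choose

@[simp]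
lemma inj_desc {Y : V} (g : ∀ n, s.X n ⟶ Y) (hg : ∀ n, s.f n ≫ g (n + 1) = g n) (n : ℕ) :
    s.inj n ≫ s.desc g hg = g n :=
  (s.exists_desc g hg).choose_spec n

variable {s} in
lemma hom_ext {Y : V} {g h : s.pt ⟶ Y} (w : ∀ n, s.inj n ≫ g = s.inj n ≫ h) : g = h :=
  colimit.hom_ext w

/-- The map from the colimit to the comonoid. -/
noncomputable def toComon : s.pt ⟶ C := s.desc s.p s.f_p

@[simp]
lemma inj_toComon (n : ℕ) : s.inj n ≫ s.toComon = s.p n := s.inj_desc ..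

/-- The comultiplication of the colimit. -/
noncomputable def comul : s.pt ⟶ s.pt ⊗ s.pt :=
  s.desc (fun n ↦ s.d n ≫ (s.inj (n + 1) ⊗ₘ s.inj (n + 1))) (fun n ↦ by
    rw [reassoc_of% s.f_d, tensorHom_comp_tensorHom, f_inj])

@[simp]
lemma inj_comul (n : ℕ) : s.inj n ≫ s.comul = s.d n ≫ (s.inj (n + 1) ⊗ₘ s.inj (n + 1)) :=
  s.inj_desc ..

/-- The colimit of the sequence is a comonoid. -/
@[reducible]
noncomputable def comonObj : ComonObj s.pt where
  counit := s.toComon ≫ ε[C]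
  comul := s.comul
  counit_comul := hom_ext fun n ↦ by
    rw [reassoc_of% s.inj_comul, ← tensorHom_id, tensorHom_comp_tensorHom, reassoc_of% s.inj_toComon,
      MonoidalCategory.tensorHom_def, reassoc_of% s.d_counit_left, Category.comp_id,
      ← leftUnitor_inv_naturality, reassoc_of% s.f_inj]
  comul_counit := hom_ext fun n ↦ by
    rw [reassoc_of% s.inj_comul, ← id_tensorHom, tensorHom_comp_tensorHom, reassoc_of% s.inj_toComon,
      MonoidalCategory.tensorHom_def', reassoc_of% s.d_counit_right, Category.comp_id,
      ← rightUnitor_inv_naturality, reassoc_of% s.f_inj]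
  comul_assoc := hom_ext fun n ↦ by
    -- The factor not comultiplied again is moved from stage `n + 1` to `n + 2` by a transition map;
    -- both sides then live at one stage and `d_assoc` applies.
    rw [reassoc_of% s.inj_comul, reassoc_of% s.inj_comul, ← tensorHom_id, ← id_tensorHom,
      tensorHom_comp_tensorHom, tensorHom_comp_tensorHom_assoc, inj_comul, Category.comp_id,
      ← s.f_inj (n + 1), ← tensorHom_comp_tensorHom, ← tensorHom_comp_tensorHom_assoc,
      associator_naturality, ← reassoc_of% s.d_assoc]

attribute [local instance] comonObj

instance : IsComonHom s.toComon where
  hom_counit := rfl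
  hom_comul := hom_ext fun n ↦ by
    change _ = s.inj n ≫ s.comul ≫ _
    rw [reassoc_of% s.inj_comul, reassoc_of% s.inj_toComon, tensorHom_comp_tensorHom, inj_toComon, s.d_p]

/-- Since `s.inj 0` is `s.f 0` followed by `s.inj 1`, compatibility with the first partial
comultiplication suffices. The counit of the colimit is pulled back from `C`, hence the form of `h`.
-/
lemma isComonHom_comp_inj {D : V} [ComonObj D] (q : D ⟶ s.X 0)
    (h : (q ≫ s.p 0) ≫ ε[C] = ε[D])
    (hq : q ≫ s.d 0 = Δ[D] ≫ ((q ≫ s.f 0) ⊗ₘ (q ≫ s.f 0))) :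
    IsComonHom (q ≫ s.inj 0) where
  hom_counit := by
    change (q ≫ s.inj 0) ≫ s.toComon ≫ ε[C] = _
    rw [Category.assoc, reassoc_of% s.inj_toComon, ← h, Category.assoc]
  hom_comul := by
    change (q ≫ s.inj 0) ≫ s.comul = _
    rw [Category.assoc, inj_comul, reassoc_of% hq, tensorHom_comp_tensorHom]
    simp

end ComonChain

section

open Cardinal

/-- A `κ`-small colimit of `κ`-presentable objects is `κ`-presentable, and `ℕ` has only countably
many arrows. This is what forces `κ` to be uncountable. -/
lemma ComonChain.isCardinalPresentable_pt {V : Type u} [Category.{v} V] [MonoidalCategory V]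
    {C : V} [ComonObj C] (s : ComonChain C) [HasColimitsOfShape ℕ V] (κ : Cardinal.{v})
    [Fact κ.IsRegular] (hκ : ℵ₀ < κ) [∀ n, IsCardinalPresentable (s.X n) κ] :
    IsCardinalPresentable s.pt κ := by
  have (n : ℕ) : IsCardinalPresentable ((Functor.ofSequence s.f).obj n) κ :=
    inferInstanceAs (IsCardinalPresentable (s.X n) κ)
  refine isCardinalPresentable_of_isColimit _ (colimit.isColimit (Functor.ofSequence s.f)) κ ?_
  have : Countable (Arrow ℕ) := by
    refine Function.Injective.countable (f := fun a : Arrow ℕ ↦ (a.left, a.right)) ?_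
    rintro ⟨a, b, f⟩ ⟨a', b', f'⟩ h
    obtain ⟨rfl, rfl⟩ := Prod.mk.inj h
    obtain rfl := Subsingleton.elim f f'
    rfl
  exact lt_of_le_of_lt (Cardinal.lift_le_aleph0.2 Cardinal.mk_le_aleph0)
    (by rwa [← Cardinal.lift_aleph0.{0, v}, Cardinal.lift_lt])

end

/-! ### Lifting the comultiplication along a filtered colimit -/

section

variable {V : Type u} [Category.{v} V] [MonoidalCategory V]
  {J : Type v} [SmallCategory J] {X : J ⥤ V} (c : Cocone X) [ComonObj c.pt]

/-- The legs of a cocone, as maps to its point. -/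
def leg {X : J ⥤ V} (c : Cocone X) (j : J) : X.obj j ⟶ c.pt := c.ι.app j

@[simp]
lemma leg_w {X : J ⥤ V} (c : Cocone X) {j k : J} (f : j ⟶ k) : X.map f ≫ leg c k = leg c j :=
  c.w f

/-- A lift of the comultiplication of the comonoid `colim X` to a map
`X.obj j ⟶ X.obj k ⊗ X.obj k`. -/
structure ComulLift (j k : J) where
  /-- the transition map -/
  hom : j ⟶ k
  /-- the lift of the comultiplication -/
  d : X.obj j ⟶ X.obj k ⊗ X.obj k
  d_leg : d ≫ (leg c k ⊗ₘ leg c k) = leg c j ≫ Δ[c.pt]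

namespace ComulLift

variable {c} {j k l : J}

/-- Composition of a lift of the comultiplication with a transition map. -/
@[simps]
def extend (s : ComulLift c j k) (f : k ⟶ l) : ComulLift c j l where
  hom := s.hom ≫ f
  d := s.d ≫ (X.map f ⊗ₘ X.map f)
  d_leg := by simp [s.d_leg]

/-- The composite of the lift of the comultiplication with the counit on the left. -/
def counitLeft (s : ComulLift c j k) : X.obj j ⟶ X.obj k :=
  s.d ≫ (leg c k ≫ ε[c.pt]) ▷ X.obj k ≫ (λ_ _).hom

/-- The composite of the lift of the comultiplication with the counit on the right. -/
def counitRight (s : ComulLift c j k) : X.obj j ⟶ X.obj k :=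
  s.d ≫ X.obj k ◁ (leg c k ≫ ε[c.pt]) ≫ (ρ_ _).hom

/-- The axioms for the counit, up to the transition map. -/
structure IsCounital (s : ComulLift c j k) : Prop where
  left : s.counitLeft = X.map s.hom
  right : s.counitRight = X.map s.hom

lemma counitLeft_extend (s : ComulLift c j k) (f : k ⟶ l) :
    (s.extend f).counitLeft = s.counitLeft ≫ X.map f := by
  simp only [counitLeft, extend_d, Category.assoc]
  rw [← leftUnitor_naturality, ← tensorHom_id, tensorHom_comp_tensorHom_assoc,
    Category.comp_id, reassoc_of% leg_w, MonoidalCategory.tensorHom_def_assoc]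

lemma counitRight_extend (s : ComulLift c j k) (f : k ⟶ l) :
    (s.extend f).counitRight = s.counitRight ≫ X.map f := by
  simp only [counitRight, extend_d, Category.assoc]
  rw [← rightUnitor_naturality, ← id_tensorHom, tensorHom_comp_tensorHom_assoc,
    Category.comp_id, reassoc_of% leg_w, MonoidalCategory.tensorHom_def'_assoc]

lemma IsCounital.extend {s : ComulLift c j k} (hs : s.IsCounital) (f : k ⟶ l) :
    (s.extend f).IsCounital where
  left := by rw [counitLeft_extend, hs.left, ← X.map_comp, extend_hom]
  right := by rw [counitRight_extend, hs.right, ← X.map_comp, extend_hom]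

lemma counitLeft_leg (s : ComulLift c j k) : s.counitLeft ≫ leg c k = leg c j := by
  have : (leg c k ≫ ε[c.pt]) ⊗ₘ leg c k = (leg c k ⊗ₘ leg c k) ≫ ε[c.pt] ▷ c.pt := by
    rw [← tensorHom_id, tensorHom_comp_tensorHom, Category.comp_id]
  rw [counitLeft, Category.assoc, Category.assoc, ← leftUnitor_naturality,
    ← MonoidalCategory.tensorHom_def_assoc, this, Category.assoc, reassoc_of% s.d_leg]
  simp

lemma counitRight_leg (s : ComulLift c j k) : s.counitRight ≫ leg c k = leg c j := by
  have : leg c k ⊗ₘ (leg c k ≫ ε[c.pt]) = (leg c k ⊗ₘ leg c k) ≫ c.pt ◁ ε[c.pt] := by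
    rw [← id_tensorHom, tensorHom_comp_tensorHom, Category.comp_id]
  rw [counitRight, Category.assoc, Category.assoc, ← rightUnitor_naturality,
    ← MonoidalCategory.tensorHom_def'_assoc, this, Category.assoc, reassoc_of% s.d_leg]
  simp

lemma d_comul_tensor (s : ComulLift c j k) :
    s.d ≫ ((leg c k ≫ Δ[c.pt]) ⊗ₘ leg c k) = leg c j ≫ Δ[c.pt] ≫ Δ[c.pt] ▷ c.pt := by
  rw [← reassoc_of% s.d_leg, ← tensorHom_id, tensorHom_comp_tensorHom, Category.comp_id]

lemma d_tensor_comul (s : ComulLift c j k) :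
    s.d ≫ (leg c k ⊗ₘ (leg c k ≫ Δ[c.pt])) = leg c j ≫ Δ[c.pt] ≫ c.pt ◁ Δ[c.pt] := by
  rw [← reassoc_of% s.d_leg, ← id_tensorHom, tensorHom_comp_tensorHom, Category.comp_id]

variable [BraidedCategory V] [MonoidalClosed V] (hc : IsColimit c)
  (κ : Cardinal.{v}) [Fact κ.IsRegular] [IsCardinalFiltered J κ]

section

include hc

/-- Filtered colimits are sifted and the tensor product is cocontinuous in each variable, so `c.pt ⊗
c.pt` is the colimit of the `X.obj j ⊗ X.obj j`. -/
lemma exists_lift_tensor {Y : V} [IsCardinalPresentable Y κ] (g : Y ⟶ c.pt ⊗ c.pt) :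
    ∃ (j : J) (h : Y ⟶ X.obj j ⊗ X.obj j), h ≫ (leg c j ⊗ₘ leg c j) = g := by
  have := isFiltered_of_isCardinalFiltered J κ
  have := IsFiltered.isSifted (C := J)
  have := preservesColimitsOfShape_prod'_tensor (J := J) (𝟭 V) (𝟭 V)
  exact IsCardinalPresentable.exists_hom_of_isColimit κ
    (isColimitOfPreserves ((𝟭 V).prod' (𝟭 V) ⋙ tensor V) hc) g

lemma exists_map_eq {Y : V} [IsCardinalPresentable Y κ] (a b : Y ⟶ X.obj j)
    (h : a ≫ leg c j = b ≫ leg c j) :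
    ∃ (k : J) (f : j ⟶ k), a ≫ X.map f = b ≫ X.map f :=
  IsCardinalPresentable.exists_eq_of_isColimit' κ hc a b h

lemma exists_map_eq_tensor {Y : V} [IsCardinalPresentable Y κ]
    (a b : Y ⟶ X.obj j ⊗ X.obj j)
    (h : a ≫ (leg c j ⊗ₘ leg c j) = b ≫ (leg c j ⊗ₘ leg c j)) :
    ∃ (k : J) (f : j ⟶ k), a ≫ (X.map f ⊗ₘ X.map f) = b ≫ (X.map f ⊗ₘ X.map f) := by
  have := isFiltered_of_isCardinalFiltered J κ
  have := IsFiltered.isSifted (C := J)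
  have := preservesColimitsOfShape_prod'_tensor (J := J) (𝟭 V) (𝟭 V)
  exact IsCardinalPresentable.exists_eq_of_isColimit' κ
    (isColimitOfPreserves ((𝟭 V).prod' (𝟭 V) ⋙ tensor V) hc) a b h

lemma exists_map_eq_tensor_tensor {Y : V} [IsCardinalPresentable Y κ]
    (a b : Y ⟶ X.obj j ⊗ (X.obj j ⊗ X.obj j))
    (h : a ≫ (leg c j ⊗ₘ (leg c j ⊗ₘ leg c j)) =
      b ≫ (leg c j ⊗ₘ (leg c j ⊗ₘ leg c j))) :
    ∃ (k : J) (f : j ⟶ k), a ≫ (X.map f ⊗ₘ (X.map f ⊗ₘ X.map f)) =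
      b ≫ (X.map f ⊗ₘ (X.map f ⊗ₘ X.map f)) := by
  have := isFiltered_of_isCardinalFiltered J κ
  have := IsFiltered.isSifted (C := J)
  have := preservesColimitsOfShape_prod'_tensor (J := J) (𝟭 V) (𝟭 V)
  have := preservesColimitsOfShape_prod'_tensor (J := J) (𝟭 V) ((𝟭 V).prod' (𝟭 V) ⋙ tensor V)
  exact IsCardinalPresentable.exists_eq_of_isColimit' κ
    (isColimitOfPreserves ((𝟭 V).prod' ((𝟭 V).prod' (𝟭 V) ⋙ tensor V) ⋙ tensor V) hc) a b h

/-- Both counit composites agree with the transition map in `c.pt`. As `X.obj j` is presentable,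
they agree at a later stage, first on the left and then on the right. -/
lemma exists_isCounital_extend [IsCardinalPresentable (X.obj j) κ] (s : ComulLift c j k) :
    ∃ (l : J) (f : k ⟶ l), (s.extend f).IsCounital := by
  obtain ⟨k₁, f₁, h₁⟩ := exists_map_eq hc κ s.counitLeft (X.map s.hom)
    (by rw [counitLeft_leg, leg_w])
  obtain ⟨k₂, f₂, h₂⟩ := exists_map_eq hc κ (s.counitRight ≫ X.map f₁) (X.map (s.hom ≫ f₁))
    (by rw [Category.assoc, leg_w, counitRight_leg, leg_w])
  refine ⟨k₂, f₁ ≫ f₂, ?_, ?_⟩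
  · rw [counitLeft_extend, X.map_comp, reassoc_of% h₁, extend_hom, X.map_comp, X.map_comp]
  · rw [counitRight_extend, X.map_comp, ← Category.assoc, h₂, extend_hom, X.map_comp, X.map_comp,
      X.map_comp, Category.assoc]

variable (j) in
lemma exists_isCounital [IsCardinalPresentable (X.obj j) κ] :
    ∃ (k : J) (s : ComulLift c j k), s.IsCounital := by
  have := isFiltered_of_isCardinalFiltered J κ
  obtain ⟨k, h, hh⟩ := exists_lift_tensor hc κ (leg c j ≫ Δ[c.pt])
  -- The stage `k` of the lift need not receive a map from `j`, so the lift is pushed to a common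
  -- successor.
  let s : ComulLift c j (IsFiltered.max j k) :=
    { hom := IsFiltered.leftToMax j k
      d := h ≫ (X.map (IsFiltered.rightToMax j k) ⊗ₘ X.map (IsFiltered.rightToMax j k))
      d_leg := by simp [hh] }
  obtain ⟨_, f, hf⟩ := s.exists_isCounital_extend hc κ
  exact ⟨_, _, hf⟩

/-- This starts the chain. The extra equation holds in the colimit because `q ≫ leg c j` is a
comonoid morphism, hence at some stage because `D` is presentable. -/
lemma exists_isCounital_of_isComonHom [IsCardinalPresentable (X.obj j) κ] {D : V}
    [ComonObj D] [IsCardinalPresentable D κ] (q : D ⟶ X.obj j) [IsComonHom (q ≫ leg c j)] :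
    ∃ (k : J) (s : ComulLift c j k), s.IsCounital ∧
      q ≫ s.d = Δ[D] ≫ ((q ≫ X.map s.hom) ⊗ₘ (q ≫ X.map s.hom)) := by
  obtain ⟨k, s, hs⟩ := exists_isCounital j hc κ
  obtain ⟨l, f, hf⟩ := exists_map_eq_tensor hc κ (q ≫ s.d)
    (Δ[D] ≫ ((q ≫ X.map s.hom) ⊗ₘ (q ≫ X.map s.hom))) (by
      have h := IsComonHom.hom_comul (q ≫ leg c j)
      rw [Category.assoc] at h
      rw [Category.assoc, s.d_leg, h]
      simp)
  exact ⟨l, s.extend f, hs.extend f, by simpa using hf⟩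

/-- This is the inductive step of the chain. In the colimit, the two equations follow from the
lifting property and from coassociativity of `c.pt`; presentability of `X.obj j` brings them down to
a stage, and further extension preserves them. -/
lemma exists_next [∀ j, IsCardinalPresentable (X.obj j) κ] (s : ComulLift c j k) :
    ∃ (l : J) (t : ComulLift c k l), t.IsCounital ∧
      X.map s.hom ≫ t.d = s.d ≫ (X.map t.hom ⊗ₘ X.map t.hom) ∧
      s.d ≫ (t.d ⊗ₘ X.map t.hom) ≫ (α_ _ _ _).hom = s.d ≫ (X.map t.hom ⊗ₘ t.d) := by
  obtain ⟨l, t, ht⟩ := exists_isCounital k hc κ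
  obtain ⟨m, f, hf⟩ := exists_map_eq_tensor hc κ (X.map s.hom ≫ t.d)
    (s.d ≫ (X.map t.hom ⊗ₘ X.map t.hom)) (by simp [s.d_leg, t.d_leg, reassoc_of% leg_w])
  obtain ⟨n, g, hg⟩ := exists_map_eq_tensor_tensor hc κ
    (s.d ≫ ((t.extend f).d ⊗ₘ X.map (t.extend f).hom) ≫ (α_ _ _ _).hom)
    (s.d ≫ (X.map (t.extend f).hom ⊗ₘ (t.extend f).d)) (by
      rw [Category.assoc, Category.assoc, Category.assoc, ← associator_naturality,
        tensorHom_comp_tensorHom_assoc, tensorHom_comp_tensorHom, (t.extend f).d_leg, leg_w,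
        d_tensor_comul, reassoc_of% s.d_comul_tensor, ComonObj.comul_assoc])
  refine ⟨n, (t.extend f).extend g, (ht.extend f).extend g, ?_, ?_⟩
  · rw [extend_d, extend_d, Category.assoc, reassoc_of% hf]
    simp
  · rw [extend_d (t.extend f), extend_hom (t.extend f), X.map_comp, ← tensorHom_comp_tensorHom,
      ← tensorHom_comp_tensorHom, Category.assoc, associator_naturality,
      ← Category.assoc s.d _ (X.map g ⊗ₘ (X.map g ⊗ₘ X.map g)), ← hg]
    simp only [Category.assoc]

end

end ComulLift

end

namespace ComulLift

variable {V : Type u} [Category.{v} V] [MonoidalCategory V]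
  {J : Type v} [SmallCategory J] {X : J ⥤ V} {c : Cocone X} [ComonObj c.pt] {j k : J}

lemma IsCounital.d_counit_left {s : ComulLift c j k} (hs : s.IsCounital) :
    s.d ≫ (leg c k ≫ ε[c.pt]) ▷ X.obj k = X.map s.hom ≫ (λ_ _).inv := by
  rw [← hs.left, counitLeft]
  simp

lemma IsCounital.d_counit_right {s : ComulLift c j k} (hs : s.IsCounital) :
    s.d ≫ X.obj k ◁ (leg c k ≫ ε[c.pt]) = X.map s.hom ≫ (ρ_ _).inv := by
  rw [← hs.right, counitRight]
  simp

/-- The chain attached to a compatible sequence of lifts of the comultiplication. -/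
def chain (a : ℕ → J) (s : ∀ n, ComulLift c (a n) (a (n + 1))) (hs : ∀ n, (s n).IsCounital)
    (h₁ : ∀ n, X.map (s n).hom ≫ (s (n + 1)).d =
      (s n).d ≫ (X.map (s (n + 1)).hom ⊗ₘ X.map (s (n + 1)).hom))
    (h₂ : ∀ n, (s n).d ≫ ((s (n + 1)).d ⊗ₘ X.map (s (n + 1)).hom) ≫ (α_ _ _ _).hom =
      (s n).d ≫ (X.map (s (n + 1)).hom ⊗ₘ (s (n + 1)).d)) : ComonChain c.pt where
  X n := X.obj (a n)
  f n := X.map (s n).hom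
  d n := (s n).d
  p n := leg c (a n)
  f_p _ := leg_w _ _
  d_p n := (s n).d_leg
  d_counit_left n := (hs n).d_counit_left
  d_counit_right n := (hs n).d_counit_right
  f_d := h₁
  d_assoc := h₂

variable [BraidedCategory V] [MonoidalClosed V] [HasColimitsOfShape ℕ V] (hc : IsColimit c)
  (κ : Cardinal.{v}) [Fact κ.IsRegular] (hκ : Cardinal.aleph0 < κ) [IsCardinalFiltered J κ]
  [∀ j, IsCardinalPresentable (X.obj j) κ]

include hc hκ

/-- Let `c.pt` be a comonoid which is a `κ`-filtered colimit of `κ`-presentable objects. If a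
morphism of comonoids from a `κ`-presentable comonoid to `c.pt` factors through `X.obj j`, then
`leg c j` factors through a `κ`-presentable comonoid over `c.pt`, compatibly with the
comonoid structures. -/
theorem exists_comonObj (j : J) {D : V} [ComonObj D] [IsCardinalPresentable D κ]
    (q : D ⟶ X.obj j) [IsComonHom (q ≫ leg c j)] :
    ∃ (E : V) (_ : ComonObj E) (a : X.obj j ⟶ E) (e : E ⟶ c.pt),
      IsCardinalPresentable E κ ∧ IsComonHom e ∧ IsComonHom (q ≫ a) ∧ a ≫ e = leg c j := by
  obtain ⟨k₀, s₀, hs₀, hq⟩ := exists_isCounital_of_isComonHom hc κ q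
  let S := Σ j k : J, { s : ComulLift c j k // s.IsCounital }
  choose l t ht h₁ h₂ using fun x : S ↦ exists_next hc κ x.2.2.1
  -- The source of `x (n + 1)` is by definition the target of `x n`, so consecutive lifts compose
  -- into a chain without transport.
  let x : ℕ → S := fun n ↦ Nat.rec ⟨j, k₀, s₀, hs₀⟩ (fun _ y ↦ ⟨y.2.1, l y, t y, ht y⟩) n
  let s : ComonChain c.pt := chain (fun n ↦ (x n).1) (fun n ↦ (x n).2.2.1) (fun n ↦ (x n).2.2.2)
    (fun n ↦ h₁ (x n)) (fun n ↦ h₂ (x n))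
  have hp (n : ℕ) : IsCardinalPresentable (s.X n) κ :=
    inferInstanceAs (IsCardinalPresentable (X.obj (x n).1) κ)
  let := s.comonObj
  refine ⟨s.pt, s.comonObj, s.inj 0, s.toComon, s.isCardinalPresentable_pt κ hκ, inferInstance,
    s.isComonHom_comp_inj q ?_ hq, s.inj_toComon 0⟩
  exact IsComonHom.hom_counit (q ≫ leg c j)

end ComulLift

/-! ### Presentable comonoids -/

section

variable (V : Type u) [Category.{v} V] [MonoidalCategory V]
  (κ : Cardinal.{v}) [Fact κ.IsRegular]

/-- The property of comonoids whose underlying object is `κ`-presentable. -/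
abbrev Comon.isPresentable : ObjectProperty (Comon V) :=
  (isCardinalPresentable V κ).inverseImage (Comon.forget V)

/-- A given object carries only a small set of comonoid structures, and any structure can be
transported along an isomorphism to a representative in a small class. -/
instance [ObjectProperty.EssentiallySmall.{v} (isCardinalPresentable V κ)] :
    ObjectProperty.EssentiallySmall.{v} (Comon.isPresentable V κ) := by
  obtain ⟨Q, _, hQ⟩ :=
    ObjectProperty.EssentiallySmall.exists_small_le'.{v} (isCardinalPresentable V κ)
  let f : (Σ q : Subtype Q, ComonObj q.1) → Comon V := fun x ↦ { X := x.1.1, comon := x.2 }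
  refine ⟨.ofObj f, inferInstance, fun C hC ↦ ?_⟩
  obtain ⟨Y, hY, ⟨e⟩⟩ := hQ _ hC
  change C.X ≅ Y at e
  let hcom : ComonObj Y :=
    { counit := e.inv ≫ ε[C.X]
      comul := e.inv ≫ Δ[C.X] ≫ (e.hom ⊗ₘ e.hom)
      counit_comul := by
        rw [Category.assoc, Category.assoc, ← tensorHom_id, tensorHom_comp_tensorHom,
          e.hom_inv_id_assoc, Category.comp_id, ComonObj.counit_comul_hom, e.inv_hom_id_assoc]
      comul_counit := by
        rw [Category.assoc, Category.assoc, ← id_tensorHom, tensorHom_comp_tensorHom,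
          e.hom_inv_id_assoc, Category.comp_id, ComonObj.comul_counit_hom, e.inv_hom_id_assoc]
      comul_assoc := by
        have h₁ : e.hom ⊗ₘ (e.hom ≫ e.inv ≫ Δ[C.X] ≫ (e.hom ⊗ₘ e.hom)) =
            C.X ◁ Δ[C.X] ≫ (e.hom ⊗ₘ (e.hom ⊗ₘ e.hom)) := by
          rw [e.hom_inv_id_assoc, ← id_tensorHom, tensorHom_comp_tensorHom, Category.id_comp]
        have h₂ : (e.hom ≫ e.inv ≫ Δ[C.X] ≫ (e.hom ⊗ₘ e.hom)) ⊗ₘ e.hom =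
            Δ[C.X] ▷ C.X ≫ ((e.hom ⊗ₘ e.hom) ⊗ₘ e.hom) := by
          rw [e.hom_inv_id_assoc, ← tensorHom_id, tensorHom_comp_tensorHom, Category.id_comp]
        simp only [Category.assoc]
        rw [← id_tensorHom, ← tensorHom_id, tensorHom_comp_tensorHom,
          tensorHom_comp_tensorHom_assoc, Category.comp_id, h₁, h₂, ComonObj.comul_assoc_assoc,
          Category.assoc, associator_naturality] }
  exact ⟨f ⟨⟨Y, hY⟩, hcom⟩, ⟨_⟩, ⟨Comon.mkIso (N := f ⟨⟨Y, hY⟩, hcom⟩) e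
    (e.hom_inv_id_assoc _) (e.hom_inv_id_assoc _)⟩⟩

variable {V κ} in
lemma Comon.isPresentable_isClosedUnderColimitsOfShape [LocallySmall.{v} V]
    {J : Type v} [SmallCategory J] [HasColimitsOfShape J V]
    (hJ : HasCardinalLT (Arrow J) κ) :
    (Comon.isPresentable V κ).IsClosedUnderColimitsOfShape J where
  colimitsOfShape_le _ := fun ⟨h⟩ ↦
    (isClosedUnderColimitsOfShape_isCardinalPresentable V hJ).colimitsOfShape_le _
      ⟨{ toColimitPresentation := h.toColimitPresentation.map (Comon.forget V)
         prop_diag_obj := h.prop_diag_obj }⟩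

/-- A `κ`-small diagram of presentable comonoids over `C` has its colimit as a cocone, since that
colimit is again presentable. -/
instance [HasColimits V] (C : Comon V) :
    IsCardinalFiltered (CostructuredArrow (Comon.isPresentable V κ).ι C) κ where
  nonempty_cocone {J} _ K hJ := ⟨by
    have := Comon.isPresentable_isClosedUnderColimitsOfShape (V := V) hJ
    exact colimit.cocone K⟩

end

/-- A morphism inducing bijections on generalized elements defined over a strong generator is an
isomorphism. -/
lemma ObjectProperty.IsStrongGenerator.isIso_of_bijective {C : Type u} [Category.{v} C]
    {P : ObjectProperty C} (hP : P.IsStrongGenerator) {X Y : C} (f : X ⟶ Y)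
    (hf : ∀ G, P G → Function.Bijective (fun g : G ⟶ X ↦ g ≫ f)) : IsIso f := by
  have : Mono f := by
    rw [hP.isSeparating.mono_iff]
    exact fun G hG g₁ g₂ h ↦ (hf G hG).1 h
  exact hP.isIso_of_mono f fun G hG ↦ (hf G hG).2

/-! ### Every comonoid is a colimit of presentable ones -/

namespace Comon

variable {V : Type u} [Category.{v} V] [MonoidalCategory V] [BraidedCategory V]
  [MonoidalClosed V] (κ : Cardinal.{v}) [Fact κ.IsRegular] (hκ : Cardinal.aleph0 < κ)
  [IsCardinalLocallyPresentable V κ]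

include hκ

/-- A morphism from a `κ`-presentable comonoid to a comonoid `C` factors through a
`κ`-presentable comonoid in which any given `κ`-presentable object over `C` is contained and a
given pair of parallel morphisms which agree in `C` is identified. -/
lemma exists_isPresentable_factorization (C : Comon V) {D : Comon V}
    (hD : isPresentable V κ D) (h : D ⟶ C) {G : V} [IsCardinalPresentable G κ] :
    (∀ g : G ⟶ C.X, ∃ (E : Comon V) (_ : isPresentable V κ E) (u : D ⟶ E) (e : E ⟶ C)
      (g' : G ⟶ E.X), u ≫ e = h ∧ g' ≫ e.hom = g) ∧
    (∀ x y : G ⟶ D.X, x ≫ h.hom = y ≫ h.hom → ∃ (E : Comon V) (_ : isPresentable V κ E)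
      (u : D ⟶ E) (e : E ⟶ C), u ≫ e = h ∧ x ≫ u.hom = y ≫ u.hom) := by
  obtain ⟨P, _, hP⟩ := HasCardinalFilteredGenerator.exists_small_generator V κ
  obtain ⟨J, _, _, ⟨p⟩⟩ := hP.exists_colimitsOfShape C.X
  have : IsFiltered J := isFiltered_of_isCardinalFiltered J κ
  have hp (j : J) : IsCardinalPresentable (p.diag.obj j) κ :=
    hP.le_isCardinalPresentable _ (p.prop_diag_obj j)
  have hDX : IsCardinalPresentable D.X κ := hD
  let c : Cocone p.diag := Cocone.mk C.X p.ι
  let : ComonObj c.pt := C.comon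
  have hc : IsColimit c := p.isColimit
  -- Once `h` factors through stage `j` in `V`, the whole stage maps to a presentable comonoid over
  -- `C`. Both claims follow by choosing a stage through which `g` factors, or at which `x` and `y`
  -- become equal.
  have key (j : J) (q : D.X ⟶ p.diag.obj j) (hq : q ≫ leg c j = h.hom) :
      ∃ (E : Comon V) (_ : isPresentable V κ E) (u : D ⟶ E) (e : E ⟶ C)
        (a : p.diag.obj j ⟶ E.X), u ≫ e = h ∧ a ≫ e.hom = leg c j ∧
        q ≫ a = u.hom := by
    have : IsComonHom (q ≫ leg c j) := hq ▸ h.isComonHom_hom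
    obtain ⟨E, _, a, e, hE, _, _, hae⟩ := ComulLift.exists_comonObj hc κ hκ j q
    exact ⟨⟨E⟩, hE, ⟨q ≫ a⟩, ⟨e⟩, a, Comon.ext ((Category.assoc _ _ _).trans (by rw [hae, hq])),
      hae, rfl⟩
  obtain ⟨j₀, q, hq⟩ := IsCardinalPresentable.exists_hom_of_isColimit κ hc h.hom
  refine ⟨fun g ↦ ?_, fun x y hxy ↦ ?_⟩
  · obtain ⟨j₁, r, hr⟩ := IsCardinalPresentable.exists_hom_of_isColimit κ hc g
    obtain ⟨E, hE, u, e, a, h₁, h₂, h₃⟩ := key (IsFiltered.max j₀ j₁)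
      (q ≫ p.diag.map (IsFiltered.leftToMax _ _))
      (by rw [Category.assoc, leg_w]; exact hq)
    refine ⟨E, hE, u, e, r ≫ p.diag.map (IsFiltered.rightToMax _ _) ≫ a, h₁, ?_⟩
    rw [Category.assoc, Category.assoc, h₂, leg_w]
    exact hr
  · obtain ⟨k, f, hf⟩ := IsCardinalPresentable.exists_eq_of_isColimit' κ hc (x ≫ q) (y ≫ q)
      (by rw [Category.assoc, Category.assoc, hq, hxy])
    obtain ⟨E, hE, u, e, a, h₁, h₂, h₃⟩ := key k (q ≫ p.diag.map f)
      (by rw [Category.assoc, leg_w]; exact hq)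
    refine ⟨E, hE, u, e, h₁, ?_⟩
    rw [Category.assoc, Category.assoc] at hf
    rw [← h₃, Category.assoc, reassoc_of% hf]

/-- The fundamental theorem of comonoids in a locally presentable category: every comonoid is a
colimit of comonoids whose underlying objects are `κ`-presentable. -/
theorem exists_colimitsOfShape_isPresentable (C : Comon V) :
    ∃ (J : Type v) (_ : SmallCategory J), (isPresentable V κ).colimitsOfShape J C := by
  let K := CostructuredArrow (isPresentable V κ).ι C
  have : HasColimitsOfShape K (Comon V) :=
    hasColimitsOfShape_of_equivalence (equivSmallModel.{v} K).symm
  have : PreservesColimitsOfShape K (Comon.forget V) :=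
    preservesColimitsOfShape_of_equiv (equivSmallModel.{v} K).symm _
  have : IsFiltered K := isFiltered_of_isCardinalFiltered K κ
  let Φ : K ⥤ Comon V := CostructuredArrow.proj _ _ ⋙ (isPresentable V κ).ι
  let c : Cocone Φ := ⟨C, ⟨fun k ↦ k.hom,
    fun _ _ f ↦ (CostructuredArrow.w f).trans (Category.comp_id _).symm⟩⟩
  let hL := isColimitOfPreserves (Comon.forget V) (colimit.isColimit Φ)
  have hc (k : K) : (colimit.ι Φ k).hom ≫ (colimit.desc Φ c).hom = k.hom.hom :=
    congrArg Hom.hom (colimit.ι_desc c k)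
  -- Any presentable comonoid through which `k` factors is itself an object of `K`, so it maps to
  -- the colimit compatibly.
  have hmk {k : K} {E : Comon V} (hE : isPresentable V κ E) (u : (Φ.obj k) ⟶ E) (e : E ⟶ C)
      (hue : u ≫ e = k.hom) : ∃ v : E ⟶ colimit Φ, u ≫ v = colimit.ι Φ k ∧
        v ≫ colimit.desc Φ c = e := by
    let k' : K := CostructuredArrow.mk (Y := ⟨E, hE⟩) (by exact e)
    let m : k ⟶ k' := CostructuredArrow.homMk (ObjectProperty.homMk u) hue
    exact ⟨colimit.ι Φ k', colimit.w Φ m, colimit.ι_desc c k'⟩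
  obtain ⟨P, _, hP⟩ := HasCardinalFilteredGenerator.exists_small_generator V κ
  have hiso : IsIso (colimit.desc Φ c).hom := by
    -- The comparison map is tested on presentable generators. For injectivity, two elements are
    -- moved to one stage of the filtered diagram and identified in a larger presentable comonoid.
    refine hP.isStrongGenerator.isIso_of_bijective _ fun G hG ↦ ⟨fun g₁ g₂ hg ↦ ?_, fun g ↦ ?_⟩
    · have : IsCardinalPresentable G κ := hP.le_isCardinalPresentable _ hG
      have hx (g : G ⟶ (colimit Φ).X) : ∃ (k : K) (x : G ⟶ (Φ.obj k).X),
          x ≫ (colimit.ι Φ k).hom = g := IsCardinalPresentable.exists_hom_of_isColimit κ hL g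
      obtain ⟨k₁, x₁, hx₁⟩ := hx g₁
      obtain ⟨k₂, x₂, hx₂⟩ := hx g₂
      obtain ⟨k, x, y, rfl, rfl⟩ : ∃ (k : K) (x y : G ⟶ (Φ.obj k).X),
          x ≫ (colimit.ι Φ k).hom = g₁ ∧ y ≫ (colimit.ι Φ k).hom = g₂ := by
        have w {k k' : K} (f : k ⟶ k') : (Φ.map f).hom ≫ (colimit.ι Φ k').hom =
          (colimit.ι Φ k).hom := congrArg Hom.hom (colimit.w Φ f)
        refine ⟨IsFiltered.max k₁ k₂, x₁ ≫ (Φ.map (IsFiltered.leftToMax k₁ k₂)).hom,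
          x₂ ≫ (Φ.map (IsFiltered.rightToMax k₁ k₂)).hom, ?_, ?_⟩
        · rw [Category.assoc, w]; exact hx₁
        · rw [Category.assoc, w]; exact hx₂
      dsimp only at hg
      rw [Category.assoc, Category.assoc, hc] at hg
      obtain ⟨E, hE, u, e, hue, huxy⟩ :=
        (exists_isPresentable_factorization κ hκ C (D := Φ.obj k) k.left.property k.hom).2 x y hg
      obtain ⟨v, hv, -⟩ := hmk hE u e hue
      rw [← hv, comp_hom', reassoc_of% huxy]
    · have : IsCardinalPresentable G κ := hP.le_isCardinalPresentable _ hG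
      -- For surjectivity, no comonoid is given to start from; the initial one serves, being
      -- presentable as an empty colimit.
      have h₀ : isPresentable V κ (⊥_ (Comon V)) := by
        have := Comon.isPresentable_isClosedUnderColimitsOfShape (V := V) (κ := κ)
          (J := Discrete PEmpty.{v + 1})
          (hasCardinalLT_of_finite _ _ (Fact.out : κ.IsRegular).aleph0_le)
        exact (isPresentable V κ).colimitsOfShape_le (Discrete PEmpty.{v + 1}) _
          ((ObjectProperty.colimitsOfShape_isEmpty_iff _ _ _).2 ⟨initialIsInitial⟩)
      obtain ⟨E, hE, -, e, g', -, hg'⟩ :=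
        (exists_isPresentable_factorization κ hκ C h₀ (initial.to C)).1 g
      let k : K := CostructuredArrow.mk (Y := ⟨E, hE⟩) (by exact e)
      exact ⟨g' ≫ (colimit.ι Φ k).hom, (Category.assoc _ _ _).trans
        ((congrArg (g' ≫ ·) (hc k)).trans hg')⟩
  have hiso' : IsIso ((Comon.forget V).map (colimit.desc Φ c)) := hiso
  have : IsIso (colimit.desc Φ c) := isIso_of_reflects_iso _ (Comon.forget V)
  have : IsIso ((colimit.isColimit Φ).desc c) := inferInstanceAs (IsIso (colimit.desc Φ c))
  let hC : IsColimit c := (colimit.isColimit Φ).ofPointIso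
  exact ⟨SmallModel.{v} K, inferInstance,
    ⟨⟨⟨_, _, hC.whiskerEquivalence (equivSmallModel.{v} K).symm⟩,
      fun k ↦ ((equivSmallModel.{v} K).inverse.obj k).left.property⟩⟩⟩

end Comon

/-- A locally presentable category is locally `κ`-presentable for some uncountable `κ`. -/
lemma IsLocallyPresentable.exists_aleph0_lt (C : Type u) [Category.{v} C]
    [IsLocallyPresentable.{v} C] : ∃ (κ : Cardinal.{v}) (_ : Fact κ.IsRegular),
      Cardinal.aleph0 < κ ∧ IsCardinalLocallyPresentable C κ := by
  obtain ⟨κ, hκ, _⟩ := IsLocallyPresentable.exists_cardinal.{v} C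
  -- Passing to the successor makes the cardinal uncountable while keeping it regular.
  have : Fact (Order.succ κ).IsRegular := ⟨Cardinal.isRegular_succ hκ.out.aleph0_le⟩
  exact ⟨Order.succ κ, this, hκ.out.aleph0_le.trans_lt (Order.lt_succ κ),
    IsCardinalLocallyPresentable.of_le C (Order.le_succ κ)⟩

end CategoryTheory

/-! ### The universal measuring comonoid -/

namespace InternalHomMon

instance convMonOp_isLeftAdjoint {V : Type u} [Category.{v} V] [MonoidalCategory V]
    [BraidedCategory V] [MonoidalClosed V] [IsLocallyPresentable.{v} V] (B : Mon V) :
    (convMonOp B).IsLeftAdjoint := by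
  obtain ⟨κ, _, hκ, _⟩ := IsLocallyPresentable.exists_aleph0_lt V
  exact Functor.isLeftAdjoint_of_exists_colimitsOfShape (Comon.isPresentable V κ)
    (Comon.exists_colimitsOfShape_isPresentable κ hκ) _

end InternalHomMon

end

theorem mainTheorem3 {V : Type u} [Category.{v} V] [MonoidalCategory V] [BraidedCategory V]
    [MonoidalClosed V] [IsLocallyPresentable.{v} V] (B : Mon V) :
    ∃ (P : (Mon V)ᵒᵖ ⥤ Comon V) (adj : InternalHomMon.convMonOp B ⊣ P)
      (e : ∀ (A : Mon V) (C : Comon V),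
        (A ⟶ InternalHomMon.convMon C B) ≃ (C ⟶ P.obj (op A))),
      (∀ (A : Mon V) (C : Comon V) (f : A ⟶ InternalHomMon.convMon C B),
        e A C f = adj.homEquiv C (op A) f.op) ∧
      (∀ {A A' : Mon V} (C : Comon V) (a : A' ⟶ A) (f : A ⟶ InternalHomMon.convMon C B),
        e A' C (a ≫ f) = e A C f ≫ P.map a.op) ∧
      (∀ (A : Mon V) {C C' : Comon V} (c : C' ⟶ C) (f : A ⟶ InternalHomMon.convMon C B),
        e A C' (f ≫ InternalHomMon.convMonMap c (𝟙 B)) = c ≫ e A C f) := by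
  let adj := Adjunction.ofIsLeftAdjoint (InternalHomMon.convMonOp B)
  exact ⟨_, adj, fun A C ↦ (opEquiv (op (InternalHomMon.convMon C B)) (op A)).symm.trans
    (adj.homEquiv C (op A)), fun _ _ _ ↦ rfl,
    fun C a f ↦ adj.homEquiv_naturality_right (X := C) f.op a.op,
    fun A _ _ c f ↦ adj.homEquiv_naturality_left (Y := op A) c f.op⟩
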